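/- For $f:[0,\infty)\to\mathbb R$, $S>0$ and $c>0$ put $(x)_+=\max(x,0)$ and $$\mathrm{TV}^c(f,S)=\sup_{n\ge1}\ \sup_{0\le s_1<t_1\le s_2<t_2\le\dots\le s_n<t_n\le S}\ \sum_{i=1}^n\big(|f(t_i)-f(s_i)|-c\big)_+,$$ $$\mathrm{UTV}^c(f,S)=\sup_{n\ge1}\ \sup_{0\le s_1<t_1<s_2<t_2<\dots<s_n<t_n\le S}\ \sum_{i=1}^n\big(f(t_i)-f(s_i)-c\big)_+,$$ and $\mathrm{DTV}^c(f,S)=\mathrm{UTV}^c(-f,S)$. For $H\in(0,1)$ let $W^H=(W^H_t)_{t\ge0}$ be a fractional Brownian motion with Hurst index $H$, that is, a centered Gaussian process with almost surely continuous trajectories and $\mathbf E(W^H_sW^H_t)=\frac12\{|s|^{2H}+|t|^{2H}-|t-s|^{2H}\}$ for $s,t\ge0$. (a) There exist universal constants $0<\bar A\le4$ and $\bar B\ge2/\pi^2$ such that for all $H\in[1/2,1)$, $S>0$ and $c\in(0,S^H]$, the variable $\mathrm{TV}^c(W^H,S)$ is almost surely finite and integrable, for every $u>0$ $$\mathbf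 P\big(|\mathrm{TV}^c(W^H,S)-\mathbf E\,\mathrm{TV}^c(W^H,S)|>u\big)\le\bar A\exp\big(-\bar B\,S^{-2H}u^2\big),$$ and, equivalently (with $u=Sc^{1-1/H}v$), for every $v>0$ $$\mathbf P\big(|\mathrm{TV}^c(W^H,S)-\mathbf E\,\mathrm{TV}^c(W^H,S)|>Sc^{1-1/H}v\big)\le\bar A\exp\big(-\bar B\,(Sc^{-1/H})^{2-2H}v^2\big).$$ (b) There exist universal constants $0<\hat A\le2$ and $\hat B\ge2/\pi^2$ such that for all $H\in[1/2,1)$, $S>0$ and $c\in(0,S^H]$, the same finiteness, integrability and two bounds, with $\hat A,\hat B$ in place of $\bar A,\bar B$, hold for $\mathrm{UTV}^c(W^H,S)$ and for $\mathrm{DTV}^c(W^H,S)$. -/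

import Mathlib

open MeasureTheory ProbabilityTheory
open scoped NNReal ENNReal

/-- Pairs of times `s ≤ a₁ < b₁ ≤ a₂ < b₂ ≤ … ≤ aₙ < bₙ ≤ t` in `[0, ∞)`. -/
structure IsWeakIntervalChain (s t : ℝ≥0) {n : ℕ} (a b : Fin n → ℝ≥0) : Prop where
  left_le : ∀ i, s ≤ a i
  lt : ∀ i, a i < b i
  le_right : ∀ i, b i ≤ t
  ordered : ∀ i j, i < j → b i ≤ a j

/-- Pairs of times `s ≤ a₁ < b₁ < a₂ < b₂ < … < aₙ < bₙ ≤ t` in `[0, ∞)`. -/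
structure IsStrictIntervalChain (s t : ℝ≥0) {n : ℕ} (a b : Fin n → ℝ≥0) : Prop where
  left_le : ∀ i, s ≤ a i
  lt : ∀ i, a i < b i
  le_right : ∀ i, b i ≤ t
  ordered : ∀ i j, i < j → b i < a j

/-- The truncated variation of `f` on `[s, t]` with truncation parameter `c`, as a supremum in
`[0, ∞]`. -/
noncomputable def truncVar (f : ℝ≥0 → ℝ) (s t : ℝ≥0) (c : ℝ) : ℝ≥0∞ :=
  ⨆ (n : ℕ) (_ : 1 ≤ n) (a : Fin n → ℝ≥0) (b : Fin n → ℝ≥0) (_ : IsWeakIntervalChain s t a b),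
    ENNReal.ofReal (∑ i, max (|f (b i) - f (a i)| - c) 0)

/-- The upward truncated variation of `f` on `[s, t]` with truncation parameter `c`. -/
noncomputable def upTruncVar (f : ℝ≥0 → ℝ) (s t : ℝ≥0) (c : ℝ) : ℝ≥0∞ :=
  ⨆ (n : ℕ) (_ : 1 ≤ n) (a : Fin n → ℝ≥0) (b : Fin n → ℝ≥0) (_ : IsStrictIntervalChain s t a b),
    ENNReal.ofReal (∑ i, max (f (b i) - f (a i) - c) 0)

/-- The downward truncated variation of `f` on `[s, t]` with truncation parameter `c`. -/
noncomputable def downTruncVar (f : ℝ≥0 → ℝ) (s t : ℝ≥0) (c : ℝ) : ℝ≥0∞ :=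
  ⨆ (n : ℕ) (_ : 1 ≤ n) (a : Fin n → ℝ≥0) (b : Fin n → ℝ≥0) (_ : IsStrictIntervalChain s t a b),
    ENNReal.ofReal (∑ i, max (f (a i) - f (b i) - c) 0)

/-- `W` is a fractional Brownian motion with Hurst index `H` under `P`: a centered Gaussian process
indexed by `[0, ∞)` with covariance `(|s|^(2H) + |t|^(2H) - |t - s|^(2H)) / 2` and almost surely
continuous trajectories. -/
structure IsFractionalBrownianMotion {Ω : Type*} [MeasurableSpace Ω] (W : ℝ≥0 → Ω → ℝ) (H : ℝ)
    (P : Measure Ω) : Prop where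
  gaussian : IsGaussianProcess W P
  centered : ∀ t, ∫ ω, W t ω ∂P = 0
  covariance : ∀ s t : ℝ≥0, ∫ ω, W s ω * W t ω ∂P =
    (1 / 2) * (|(s : ℝ)| ^ (2 * H) + |(t : ℝ)| ^ (2 * H) - |(t : ℝ) - s| ^ (2 * H))
  continuous_paths : ∀ᵐ ω ∂P, Continuous (fun t => W t ω)

/-- The `[0, ∞]`-valued random quantity `X` is almost surely finite and integrable, and its
deviations from its mean satisfy the Gaussian bound with constants `A`, `B`, in terms of `u` and
in terms of `v`, where `u = S * c ^ (1 - 1 / H) * v`. -/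
structure GaussianDeviationBound {Ω : Type*} [MeasurableSpace Ω] (P : Measure Ω) (X : Ω → ℝ≥0∞)
    (H : ℝ) (S : ℝ≥0) (c A B : ℝ) : Prop where
  ae_finite : ∀ᵐ ω ∂P, X ω ≠ ∞
  integrable : Integrable (fun ω => (X ω).toReal) P
  bound : ∀ u : ℝ, 0 < u →
    P.real {ω | u < |(X ω).toReal - ∫ ω', (X ω').toReal ∂P|} ≤
      A * Real.exp (-(B * (S : ℝ) ^ (-(2 * H)) * u ^ 2))
  bound' : ∀ v : ℝ, 0 < v →
    P.real {ω | (S : ℝ) * c ^ (1 - 1 / H) * v <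
        |(X ω).toReal - ∫ ω', (X ω').toReal ∂P|} ≤
      A * Real.exp (-(B * ((S : ℝ) * c ^ (-(1 / H))) ^ (2 - 2 * H) * v ^ 2))

/-! Since `(|x| - c)₊` is the maximum of `σ x - c |σ|` over `σ ∈ {-1, 0, 1}`, each truncated
variation is a supremum, over chains of intervals and signs, of a signed sum of increments of `W`
minus a deterministic penalty. Restricting the signs to `{0, 1}` or `{0, -1}` gives the upward or
downward version. Path continuity allows end points from a countable dense set (`isLUB_chainVar`),
so the supremum is that of a Gaussian sequence with drift.

Two facts then suffice. For `H ≥ 1/2` increments over ordered intervals are nonnegatively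
correlated, so a signed sum has variance at most that of `W_S`, namely `S ^ (2 * H)`
(`integral_sq_signed_sum_le`). And the Maurey–Pisier inequality (`hasSubgaussianMGF`), applied to
finite maxima and passed to the limit, bounds the deviations by the largest variance `L` alone. Its
variance proxy `L (π/2)²` gives `2 exp(-u² / (2 L (π/2)²))`, whence the constants `2` and `2/π²`.

In `HasSubgradients`, `L` enters the final bound; the norm bound `M` serves only integrability and
an error term that vanishes in the limit. -/

/-! ### Functions with controlled subgradients -/

section Subgradients

variable {E : Type*} [NormedAddCommGroup E] [NormedSpace ℝ E] [MeasurableSpace E]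
  {μ : Measure E} {F : E → ℝ} {L M : ℝ}

/-- `F` has at each point a subgradient of norm at most `M`, whose variance under `μ` is at most
`L`. -/
structure HasSubgradients (μ : Measure E) (F : E → ℝ) (L M : ℝ) : Prop where
  nonneg : 0 ≤ M
  exists_subgradient : ∀ x, ∃ ℓ : StrongDual ℝ E,
    Var[ℓ; μ] ≤ L ∧ ‖ℓ‖ ≤ M ∧ ∀ y, F x - F y ≤ ℓ (x - y)

namespace HasSubgradients

lemma sub_le (hF : HasSubgradients μ F L M) (x y : E) : F x - F y ≤ M * ‖x - y‖ := by
  obtain ⟨ℓ, -, hℓ, h⟩ := hF.exists_subgradient x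
  calc F x - F y ≤ ℓ (x - y) := h y
    _ ≤ ‖ℓ (x - y)‖ := Real.le_norm_self _
    _ ≤ M * ‖x - y‖ := ℓ.le_of_opNorm_le hℓ _

lemma continuous (hF : HasSubgradients μ F L M) : Continuous F := by
  refine (LipschitzWith.of_dist_le_mul (K := ⟨M, hF.nonneg⟩) fun x y ↦ ?_).continuous
  rw [Real.dist_eq, dist_eq_norm, abs_le]
  have h1 := hF.sub_le x y
  have h2 := hF.sub_le y x
  rw [norm_sub_rev] at h2
  change -(M * ‖x - y‖) ≤ _ ∧ _ ≤ M * ‖x - y‖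
  constructor <;> linarith

end HasSubgradients

end Subgradients

/-! ### Maurey–Pisier concentration for Gaussian measures -/

section GaussianMeasure

variable {E : Type*} [NormedAddCommGroup E] [NormedSpace ℝ E] [MeasurableSpace E] [BorelSpace E]
  [CompleteSpace E] [SecondCountableTopology E]

/-- Fernique's theorem together with `a r ≤ a² / (4 C) + C r²`. -/
lemma IsGaussian.integrable_exp_mul_norm (μ : Measure E) [IsGaussian μ] (a : ℝ) :
    Integrable (fun x ↦ Real.exp (a * ‖x‖)) μ := by
  obtain ⟨C, hC, hint⟩ := IsGaussian.exists_integrable_exp_sq μ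
  refine (hint.const_mul (Real.exp (a ^ 2 / (4 * C)))).mono' (by fun_prop) (ae_of_all _ fun x ↦ ?_)
  rw [Real.norm_of_nonneg (Real.exp_nonneg _), ← Real.exp_add]
  gcongr
  have h : a ^ 2 / (4 * C) + C * ‖x‖ ^ 2 - a * ‖x‖ = (a - 2 * C * ‖x‖) ^ 2 / (4 * C) := by
    field_simp
    ring
  have : 0 ≤ (a - 2 * C * ‖x‖) ^ 2 / (4 * C) := by positivity
  linarith

lemma IsGaussian.integral_exp_mul_dual {μ : Measure E} [IsGaussian μ] (hμ : μ[id] = 0)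
    (ℓ : StrongDual ℝ E) (t : ℝ) :
    ∫ y, Real.exp (t * ℓ y) ∂μ = Real.exp (Var[ℓ; μ] * t ^ 2 / 2) := by
  have h0 : μ[ℓ] = 0 := by
    rw [IsGaussian.integral_dual]
    simp only [id_eq] at hμ
    simp [hμ]
  have h := mgf_gaussianReal (p := μ) (X := ℓ) (IsGaussian.map_eq_gaussianReal ℓ) t
  rw [mgf, h0] at h
  rw [h, Real.coe_toNNReal _ (variance_nonneg _ _)]
  simp

variable {μ : Measure E} [IsGaussian μ] {F : E → ℝ} {L M : ℝ}

namespace HasSubgradients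

lemma integrable_exp_mul (hF : HasSubgradients μ F L M) (t : ℝ) :
    Integrable (fun x ↦ Real.exp (t * F x)) μ := by
  have hc := hF.continuous
  refine ((IsGaussian.integrable_exp_mul_norm μ (|t| * M)).const_mul
    (Real.exp (t * F 0))).mono' (by fun_prop) (ae_of_all _ fun x ↦ ?_)
  rw [Real.norm_of_nonneg (Real.exp_nonneg _), ← Real.exp_add]
  gcongr
  have h1 := hF.sub_le x 0
  have h2 := hF.sub_le 0 x
  rw [zero_sub, norm_neg] at h2
  rw [sub_zero] at h1
  have h3 : |F x - F 0| ≤ M * ‖x‖ := abs_le.2 ⟨by linarith, h1⟩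
  have h4 : t * (F x - F 0) ≤ |t| * (M * ‖x‖) := by
    refine (le_abs_self _).trans ?_
    rw [abs_mul]
    gcongr
  linarith

lemma integrable (hF : HasSubgradients μ F L M) : Integrable F μ := by
  have hc := hF.continuous
  refine ((hF.integrable_exp_mul 1).add (hF.integrable_exp_mul (-1))).mono' (by fun_prop)
    (ae_of_all _ fun x ↦ ?_)
  simp only [Pi.add_apply, one_mul, neg_mul]
  have h1 := Real.add_one_le_exp (F x)
  have h2 := Real.add_one_le_exp (-F x)
  have h3 := Real.exp_pos (F x)
  have h4 := Real.exp_pos (-F x)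
  rw [Real.norm_eq_abs, abs_le]
  constructor <;> linarith

lemma integrable_exp_mul_sub (hF : HasSubgradients μ F L M) (t : ℝ) :
    Integrable (fun p : E × E ↦ Real.exp (t * (F p.1 - F p.2))) (μ.prod μ) := by
  refine ((hF.integrable_exp_mul t).mul_prod (hF.integrable_exp_mul (-t))).congr
    (ae_of_all _ fun p ↦ ?_)
  simp only [← Real.exp_add]
  congr 1
  ring

lemma integrable_exp_mul_sub_rotation (hF : HasSubgradients μ F L M) (hμ : μ[id] = 0) (t α β : ℝ) :
    Integrable (fun p : E × E ↦ Real.exp (t * (F (Real.cos α • p.1 + Real.sin α • p.2)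
      - F (Real.cos β • p.1 + Real.sin β • p.2)))) (μ.prod μ) := by
  have hc := hF.continuous
  -- By rotation invariance `cos γ • x + sin γ • y` again has law `μ`. The difference in the
  -- exponent is then split by `exp (a - b) ≤ exp (2a) + exp (-2b)`.
  have key : ∀ (s γ : ℝ), Integrable (fun p : E × E ↦
      Real.exp (s * F (Real.cos γ • p.1 + Real.sin γ • p.2))) (μ.prod μ) := by
    intro s γ
    have h := (hF.integrable_exp_mul s).comp_fst μ
    rw [← IsGaussian.map_rotation_eq_self hμ γ] at h
    rw [integrable_map_measure (by fun_prop) (by fun_prop)] at h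
    refine h.congr (ae_of_all _ fun p ↦ ?_)
    simp [ContinuousLinearMap.rotation_apply]
  refine ((key (2 * t) α).add (key (-2 * t) β)).mono' (by fun_prop) (ae_of_all _ fun p ↦ ?_)
  rw [Real.norm_of_nonneg (Real.exp_nonneg _)]
  simp only [Pi.add_apply]
  set a := t * F (Real.cos α • p.1 + Real.sin α • p.2)
  set b := t * F (Real.cos β • p.1 + Real.sin β • p.2)
  have e1 : Real.exp (2 * t * F (Real.cos α • p.1 + Real.sin α • p.2)) = Real.exp a ^ 2 := by
    rw [← Real.exp_nat_mul]; congr 1; simp only [a]; push_cast; ring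
  have e2 : Real.exp (-2 * t * F (Real.cos β • p.1 + Real.sin β • p.2)) = Real.exp (-b) ^ 2 := by
    rw [← Real.exp_nat_mul]; congr 1; simp only [b]; push_cast; ring
  rw [e1, e2, show t * (F (Real.cos α • p.1 + Real.sin α • p.2)
      - F (Real.cos β • p.1 + Real.sin β • p.2)) = a + -b by simp only [a, b]; ring, Real.exp_add]
  nlinarith [sq_nonneg (Real.exp a - Real.exp (-b)), sq_nonneg (Real.exp a),
    sq_nonneg (Real.exp (-b))]

/-- The subgradient `ℓ` at `x` bounds the increment by `(1 - cos θ) ℓ x - sin θ ℓ y`. For fixed `x`,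
`ℓ y` is a centered Gaussian of variance at most `L`, which gives the main factor; the first term is
of order `θ²` and gives the error factor. -/
lemma integral_exp_mul_sub_rotation_le (hF : HasSubgradients μ F L M) (hμ : μ[id] = 0) {t : ℝ}
    (ht : 0 ≤ t) (θ : ℝ) :
    ∫ p : E × E, Real.exp (t * (F p.1 - F (Real.cos θ • p.1 + Real.sin θ • p.2))) ∂(μ.prod μ) ≤
      Real.exp (L * (t * θ) ^ 2 / 2) * ∫ x, Real.exp (t * θ ^ 2 / 2 * M * ‖x‖) ∂μ := by
  have hint := hF.integrable_exp_mul_sub_rotation hμ t 0 θ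
  simp only [Real.cos_zero, Real.sin_zero, one_smul, zero_smul, add_zero] at hint
  rw [integral_prod _ hint, ← integral_const_mul]
  refine integral_mono_ae hint.integral_prod_left
    ((IsGaussian.integrable_exp_mul_norm μ _).const_mul _) ?_
  filter_upwards [hint.prod_right_ae] with x hx
  obtain ⟨ℓ, hvar, hnorm, hsub⟩ := hF.exists_subgradient x
  -- A non-integrable function has integral `0` by convention, which the positive value of the
  -- moment generating function excludes.
  have hexp : ∀ s : ℝ, Integrable (fun y ↦ Real.exp (s * ℓ y)) μ := by
    intro s
    by_contra h
    have h1 := IsGaussian.integral_exp_mul_dual hμ ℓ s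
    rw [integral_undef h] at h1
    exact (Real.exp_pos _).ne h1
  have hcos : 1 - Real.cos θ ≤ θ ^ 2 / 2 := by linarith [Real.one_sub_sq_div_two_le_cos (x := θ)]
  have hcos' : 0 ≤ 1 - Real.cos θ := by linarith [Real.cos_le_one θ]
  have hsin : Real.sin θ ^ 2 ≤ θ ^ 2 := Real.sin_sq_le_sq
  have hℓx : ℓ x ≤ M * ‖x‖ := (Real.le_norm_self _).trans (ℓ.le_of_opNorm_le hnorm _)
  calc ∫ y, Real.exp (t * (F x - F (Real.cos θ • x + Real.sin θ • y))) ∂μ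
      ≤ ∫ y, Real.exp (t * (1 - Real.cos θ) * ℓ x) *
          Real.exp ((-(t * Real.sin θ)) * ℓ y) ∂μ := by
        refine integral_mono hx ((hexp _).const_mul _) fun y ↦ ?_
        simp only
        rw [← Real.exp_add]
        gcongr
        have h := hsub (Real.cos θ • x + Real.sin θ • y)
        simp only [map_sub, map_add, map_smul, smul_eq_mul] at h
        nlinarith
    _ = Real.exp (t * (1 - Real.cos θ) * ℓ x) *
          Real.exp (Var[ℓ; μ] * (t * Real.sin θ) ^ 2 / 2) := by
        rw [integral_const_mul, IsGaussian.integral_exp_mul_dual hμ, neg_sq]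
    _ ≤ Real.exp (t * θ ^ 2 / 2 * M * ‖x‖) * Real.exp (L * (t * θ) ^ 2 / 2) := by
        have hv := variance_nonneg ℓ μ
        gcongr ?_ * ?_
        · refine Real.exp_le_exp.2 ?_
          calc t * (1 - Real.cos θ) * ℓ x ≤ t * (1 - Real.cos θ) * (M * ‖x‖) := by gcongr
            _ ≤ t * (θ ^ 2 / 2) * (M * ‖x‖) := by
              have := mul_nonneg hF.nonneg (norm_nonneg x)
              gcongr
            _ = _ := by ring
        · have hL := hv.trans hvar
          gcongr Real.exp (?_ / 2)
          rw [mul_pow, mul_pow]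
          gcongr
    _ = _ := mul_comm _ _

/-- The quarter turn from `x` to `y` is cut into `n` steps of angle `h = π / (2n)`. Convexity turns
the telescoping sum into an average with exponent `n t`; as `n t h = t π / 2`, the main factor does
not depend on `n`, while `n t h²` is of order `1 / n`. -/
lemma integral_exp_mul_sub_le_of_pos (hF : HasSubgradients μ F L M) (hμ : μ[id] = 0) {t : ℝ}
    (ht : 0 ≤ t) {n : ℕ} (hn : 0 < n) :
    ∫ p : E × E, Real.exp (t * (F p.1 - F p.2)) ∂(μ.prod μ) ≤
      Real.exp (L * (t * (Real.pi / 2)) ^ 2 / 2) *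
        ∫ x, Real.exp (t * (Real.pi / 2) ^ 2 / 2 * M * ‖x‖ * (1 / (n : ℝ))) ∂μ := by
  have hn' : (0 : ℝ) < n := by exact_mod_cast hn
  set h : ℝ := Real.pi / 2 / n with hh
  have hc := hF.continuous
  let G : ℕ → E × E → ℝ := fun j p ↦ F (Real.cos (j * h) • p.1 + Real.sin (j * h) • p.2)
  have hGint : ∀ j, Integrable (fun p ↦ Real.exp (n * t * (G j p - G (j + 1) p))) (μ.prod μ) :=
    fun j ↦ hF.integrable_exp_mul_sub_rotation hμ _ _ _
  have hstep : ∀ j, ∫ p, Real.exp (n * t * (G j p - G (j + 1) p)) ∂(μ.prod μ) ≤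
      Real.exp (L * (n * t * h) ^ 2 / 2) * ∫ x, Real.exp (n * t * h ^ 2 / 2 * M * ‖x‖) ∂μ := by
    intro j
    -- Rotating the pair by `j h` preserves `μ.prod μ` and carries step `0` to step `j`.
    refine le_trans (le_of_eq ?_) (hF.integral_exp_mul_sub_rotation_le hμ (by positivity) h)
    conv_rhs => rw [← IsGaussian.map_rotation_eq_self hμ (j * h)]
    rw [integral_map (by fun_prop) (by fun_prop)]
    refine integral_congr_ae (ae_of_all _ fun p ↦ ?_)
    simp only [G, ContinuousLinearMap.rotation_apply]
    congr 4
    rw [show ((j + 1 : ℕ) : ℝ) * h = j * h + h by push_cast; ring, Real.cos_add, Real.sin_add]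
    module
  have hle : ∀ p : E × E, Real.exp (t * (F p.1 - F p.2)) ≤
      ∑ j ∈ Finset.range n, (1 / (n : ℝ)) * Real.exp (n * t * (G j p - G (j + 1) p)) := by
    intro p
    have h0 : G 0 p = F p.1 := by simp [G]
    have h1 : G n p = F p.2 := by
      have : (n : ℝ) * h = Real.pi / 2 := by rw [hh]; field_simp
      simp [G, this]
    have htel : F p.1 - F p.2 = ∑ j ∈ Finset.range n, (G j p - G (j + 1) p) := by
      rw [Finset.sum_range_sub', h0, h1]
    have hconv := convexOn_exp.map_sum_le (t := Finset.range n) (w := fun _ ↦ 1 / (n : ℝ))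
      (p := fun j ↦ n * t * (G j p - G (j + 1) p)) (fun _ _ ↦ by positivity)
      (by simp [hn'.ne']) (fun _ _ ↦ Set.mem_univ _)
    simp only [smul_eq_mul] at hconv
    refine le_trans (le_of_eq ?_) hconv
    congr 1
    rw [htel, Finset.mul_sum]
    refine Finset.sum_congr rfl fun j _ ↦ ?_
    field_simp
  calc ∫ p : E × E, Real.exp (t * (F p.1 - F p.2)) ∂(μ.prod μ)
      ≤ ∫ p, ∑ j ∈ Finset.range n, (1 / (n : ℝ)) * Real.exp (n * t * (G j p - G (j + 1) p))
          ∂(μ.prod μ) :=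
        integral_mono (hF.integrable_exp_mul_sub t)
          (integrable_finsetSum _ fun j _ ↦ (hGint j).const_mul _) hle
    _ = ∑ j ∈ Finset.range n, (1 / (n : ℝ)) *
          ∫ p, Real.exp (n * t * (G j p - G (j + 1) p)) ∂(μ.prod μ) := by
        rw [integral_finsetSum _ fun j _ ↦ (hGint j).const_mul _]
        simp_rw [integral_const_mul]
    _ ≤ ∑ j ∈ Finset.range n, (1 / (n : ℝ)) * (Real.exp (L * (n * t * h) ^ 2 / 2) *
          ∫ x, Real.exp (n * t * h ^ 2 / 2 * M * ‖x‖) ∂μ) := by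
        gcongr with j _
        exact hstep j
    _ = Real.exp (L * (n * t * h) ^ 2 / 2) * ∫ x, Real.exp (n * t * h ^ 2 / 2 * M * ‖x‖) ∂μ := by
        rw [Finset.sum_const, Finset.card_range, nsmul_eq_mul]
        field_simp
    _ = _ := by
        rw [show (n : ℝ) * t * h = t * (Real.pi / 2) by rw [hh]; field_simp]
        congr 3 with x
        congr 1
        rw [hh]
        field_simp

lemma integral_exp_mul_sub_le_of_nonneg (hF : HasSubgradients μ F L M) (hμ : μ[id] = 0) {t : ℝ}
    (ht : 0 ≤ t) :
    ∫ p : E × E, Real.exp (t * (F p.1 - F p.2)) ∂(μ.prod μ) ≤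
      Real.exp (L * (t * (Real.pi / 2)) ^ 2 / 2) := by
  have hM := hF.nonneg
  set a := t * (Real.pi / 2) ^ 2 / 2 * M with ha
  have ha0 : 0 ≤ a := by positivity
  have hlim : Filter.Tendsto (fun n : ℕ ↦ ∫ x, Real.exp (a * ‖x‖ * (1 / (n : ℝ))) ∂μ)
      Filter.atTop (nhds 1) := by
    rw [show nhds (1 : ℝ) = nhds (∫ _, (1 : ℝ) ∂μ) by simp]
    refine tendsto_integral_of_dominated_convergence (fun x ↦ Real.exp (a * ‖x‖))
      (fun n ↦ by fun_prop) (IsGaussian.integrable_exp_mul_norm μ a)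
      (fun n ↦ ae_of_all _ fun x ↦ ?_)
      (ae_of_all _ fun x ↦ ?_)
    · rw [Real.norm_of_nonneg (Real.exp_nonneg _)]
      refine Real.exp_le_exp.2 (mul_le_of_le_one_right (by positivity) ?_)
      rw [one_div]
      exact Nat.cast_inv_le_one n
    · have := (tendsto_one_div_atTop_nhds_zero_nat (𝕜 := ℝ)).const_mul (a * ‖x‖)
      rw [mul_zero] at this
      have h := (Real.continuous_exp.tendsto _).comp this
      rw [Real.exp_zero] at h
      exact h
  have hlim' := hlim.const_mul (Real.exp (L * (t * (Real.pi / 2)) ^ 2 / 2))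
  rw [mul_one] at hlim'
  refine ge_of_tendsto hlim' ?_
  filter_upwards [Filter.eventually_gt_atTop 0] with n hn
  exact hF.integral_exp_mul_sub_le_of_pos hμ ht hn

lemma integral_exp_mul_sub_le (hF : HasSubgradients μ F L M) (hμ : μ[id] = 0) (t : ℝ) :
    ∫ p : E × E, Real.exp (t * (F p.1 - F p.2)) ∂(μ.prod μ) ≤
      Real.exp (L * (t * (Real.pi / 2)) ^ 2 / 2) := by
  rcases le_total 0 t with ht | ht
  · exact hF.integral_exp_mul_sub_le_of_nonneg hμ ht
  · have h := hF.integral_exp_mul_sub_le_of_nonneg hμ (neg_nonneg.2 ht)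
    -- Exchanging the two independent copies changes the sign of `t`.
    rw [← integral_prod_swap] at h
    refine le_trans (le_of_eq ?_) (h.trans (le_of_eq ?_))
    · refine integral_congr_ae (ae_of_all _ fun p ↦ ?_)
      simp only [Prod.fst_swap, Prod.snd_swap]
      congr 1
      ring
    · congr 2
      ring

/-- The Maurey–Pisier Gaussian concentration inequality. -/
theorem hasSubgaussianMGF (hF : HasSubgradients μ F L M) (hμ : μ[id] = 0) {K : ℝ≥0}
    (hK : L * (Real.pi / 2) ^ 2 ≤ K) :
    HasSubgaussianMGF (fun x ↦ F x - ∫ y, F y ∂μ) K μ where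
  integrable_exp_mul t := by
    simp_rw [mul_sub, Real.exp_sub]
    exact (hF.integrable_exp_mul t).div_const _
  mgf_le t := by
    have hint := hF.integrable_exp_mul_sub t
    calc mgf (fun x ↦ F x - ∫ y, F y ∂μ) μ t
        ≤ ∫ x, ∫ y, Real.exp (t * (F x - F y)) ∂μ ∂μ := by
          refine integral_mono_ae ?_ hint.integral_prod_left ?_
          · simp_rw [mul_sub, Real.exp_sub]
            exact (hF.integrable_exp_mul t).div_const _
          · filter_upwards [hint.prod_right_ae] with x hx
            have hi : Integrable (fun y ↦ t * (F x - F y)) μ :=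
              ((integrable_const _).sub hF.integrable).const_mul t
            -- Jensen's inequality in the independent copy `y` replaces `F y` by its mean.
            have h := convexOn_exp.map_integral_le Real.continuous_exp.continuousOn isClosed_univ
              (ae_of_all μ fun _ ↦ Set.mem_univ _) hi hx
            refine le_trans (le_of_eq ?_) h
            congr 1
            rw [integral_const_mul, integral_sub (integrable_const _) hF.integrable]
            simp
      _ = ∫ p : E × E, Real.exp (t * (F p.1 - F p.2)) ∂(μ.prod μ) := (integral_prod _ hint).symm
      _ ≤ Real.exp (L * (t * (Real.pi / 2)) ^ 2 / 2) := hF.integral_exp_mul_sub_le hμ t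
      _ ≤ Real.exp (K * t ^ 2 / 2) := by
          gcongr Real.exp (?_ / 2)
          rw [mul_pow, mul_left_comm, mul_comm]
          gcongr

end HasSubgradients

end GaussianMeasure

/-! ### Concentration for suprema of Gaussian sequences -/

section GaussianSupremum

variable {Ω : Type*} [MeasurableSpace Ω] {P : Measure Ω}

/-- A coordinate attaining the maximum at `x` is a subgradient there: the drift `b` cancels in the
difference, and coordinates have norm at most `1` for the sup norm. -/
lemma hasSubgradients_iSup {ι : Type*} [Fintype ι] [Nonempty ι] {μ : Measure (ι → ℝ)} {L : ℝ}
    (b : ι → ℝ) (hvar : ∀ i, Var[fun x ↦ x i; μ] ≤ L) :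
    HasSubgradients μ (fun x ↦ ⨆ i, (x i + b i)) L 1 where
  nonneg := zero_le_one
  exists_subgradient x := by
    obtain ⟨i, hi⟩ := exists_eq_ciSup_of_finite (f := fun i ↦ x i + b i)
    refine ⟨ContinuousLinearMap.proj (R := ℝ) (φ := fun _ : ι ↦ ℝ) i, hvar i, ?_, fun y ↦ ?_⟩
    · refine ContinuousLinearMap.opNorm_le_bound _ zero_le_one fun y ↦ ?_
      rw [one_mul]
      exact norm_le_pi_norm y i
    · have h := le_ciSup (Set.finite_range fun i ↦ y i + b i).bddAbove i
      change _ - (⨆ i, (y i + b i)) ≤ x i - y i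
      rw [← hi]
      linarith

/-- Fatou's lemma: the strict inequality is an open condition, so its indicator is lower
semicontinuous along the sequence. -/
lemma measureReal_lt_abs_le_of_tendsto [IsFiniteMeasure P] {Y : ℕ → Ω → ℝ} {Z : Ω → ℝ}
    (hY : ∀ n, AEMeasurable (Y n) P)
    (hlim : ∀ᵐ ω ∂P, Filter.Tendsto (fun n ↦ Y n ω) Filter.atTop (nhds (Z ω))) {u C : ℝ}
    (hC : ∀ n, P.real {ω | u < |Y n ω|} ≤ C) : P.real {ω | u < |Z ω|} ≤ C := by
  have hZ : AEMeasurable Z P := aemeasurable_of_tendsto_metrizable_ae' hY hlim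
  have hS : ∀ {g : Ω → ℝ}, AEMeasurable g P → NullMeasurableSet {ω | u < |g ω|} P :=
    fun hg ↦ nullMeasurableSet_lt aemeasurable_const hg.abs
  have hC' : ∀ n, P {ω | u < |Y n ω|} ≤ ENNReal.ofReal C := fun n ↦ by
    rw [← ofReal_measureReal]
    exact ENNReal.ofReal_le_ofReal (hC n)
  have hC0 : 0 ≤ C := measureReal_nonneg.trans (hC 0)
  refine ENNReal.toReal_le_of_le_ofReal hC0 ?_
  calc P {ω | u < |Z ω|} = ∫⁻ ω, {ω | u < |Z ω|}.indicator 1 ω ∂P :=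
        (lintegral_indicator_one₀ (hS hZ)).symm
    _ ≤ ∫⁻ ω, Filter.liminf (fun n ↦ {ω | u < |Y n ω|}.indicator 1 ω) Filter.atTop ∂P := by
        refine lintegral_mono_ae ?_
        filter_upwards [hlim] with ω hω
        by_cases h : u < |Z ω|
        · refine Filter.le_liminf_of_le (by isBoundedDefault) ?_
          filter_upwards [hω.abs.eventually_const_lt h] with n hn
          simp [Set.indicator, h, hn]
        · simp [Set.indicator, h]
    _ ≤ Filter.liminf (fun n ↦ ∫⁻ ω, {ω | u < |Y n ω|}.indicator 1 ω ∂P) Filter.atTop :=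
        lintegral_liminf_le' fun n ↦ measurable_one.aemeasurable.indicator₀ (hS (hY n))
    _ ≤ ENNReal.ofReal C := by
        simp_rw [fun n ↦ lintegral_indicator_one₀ (hS (hY n))]
        exact Filter.liminf_le_of_le (by isBoundedDefault) fun c hc ↦ by
          obtain ⟨n, hn⟩ := hc.exists
          exact hn.trans (hC' n)

lemma HasGaussianLaw.hasSubgaussianMGF_iSup {ι : Type*} [Fintype ι] [Nonempty ι] {X : ι → Ω → ℝ}
    (hX : HasGaussianLaw (fun ω i ↦ X i ω) P) (hmean : ∀ i, ∫ ω, X i ω ∂P = 0) {L : ℝ}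
    (hvar : ∀ i, Var[X i; P] ≤ L) (b : ι → ℝ) {K : ℝ≥0} (hK : L * (Real.pi / 2) ^ 2 ≤ K) :
    Integrable (fun ω ↦ ⨆ i, (X i ω + b i)) P ∧
    HasSubgaussianMGF (fun ω ↦ (⨆ i, (X i ω + b i)) - ∫ ω', ⨆ i, (X i ω' + b i) ∂P) K P := by
  have hm : AEMeasurable (fun ω i ↦ X i ω) P := hX.aemeasurable
  set μ := P.map (fun ω i ↦ X i ω) with hμdef
  have hG : IsGaussian μ := hX.isGaussian_map
  have hsub : HasSubgradients μ (fun x ↦ ⨆ i, (x i + b i)) L 1 := by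
    refine hasSubgradients_iSup b fun i ↦ ?_
    rw [variance_map (measurable_pi_apply i).aemeasurable hm]
    exact hvar i
  have h0 : μ[id] = 0 := by
    ext i
    have h1 := IsGaussian.integral_dual (μ := μ)
      (ContinuousLinearMap.proj (R := ℝ) (φ := fun _ : ι ↦ ℝ) i)
    simp only [ContinuousLinearMap.proj_apply] at h1
    simp only [id_eq, Pi.zero_apply]
    rw [← h1, integral_map hm (measurable_pi_apply i).aestronglyMeasurable]
    exact hmean i
  have hc := hsub.continuous
  have hint := hsub.integrable
  rw [integrable_map_measure hc.aestronglyMeasurable hm] at hint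
  refine ⟨hint, ?_⟩
  have h := HasSubgaussianMGF.of_map hm (hsub.hasSubgaussianMGF h0 hK)
  rw [integral_map hm hc.aestronglyMeasurable] at h
  exact h

variable [IsProbabilityMeasure P]

lemma HasSubgaussianMGF.measure_lt_abs_le {Y : Ω → ℝ} {K : ℝ≥0} (hY : HasSubgaussianMGF Y K P)
    {u : ℝ} (hu : 0 ≤ u) : P.real {ω | u < |Y ω|} ≤ 2 * Real.exp (-u ^ 2 / (2 * K)) := by
  calc P.real {ω | u < |Y ω|} ≤ P.real ({ω | u ≤ Y ω} ∪ {ω | u ≤ (-Y) ω}) := by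
        refine measureReal_mono fun ω (hω : u < |Y ω|) ↦ ?_
        rcases lt_abs.1 hω with h | h
        · exact Or.inl h.le
        · exact Or.inr h.le
    _ ≤ P.real {ω | u ≤ Y ω} + P.real {ω | u ≤ (-Y) ω} := measureReal_union_le _ _
    _ ≤ _ := by
        rw [two_mul]
        exact add_le_add (hY.measure_ge_le hu) (hY.neg.measure_ge_le hu)

/-- The partial maxima of a sequence. -/
noncomputable def partialMax (x : ℕ → ℝ) (n : ℕ) : ℝ := ⨆ i : Finset.range (n + 1), x i

lemma le_partialMax (x : ℕ → ℝ) {k n : ℕ} (h : k ≤ n) : x k ≤ partialMax x n :=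
  le_ciSup (f := fun i : Finset.range (n + 1) ↦ x i) (Set.finite_range _).bddAbove
    ⟨k, by simpa using Nat.lt_succ_of_le h⟩

lemma partialMax_le {x : ℕ → ℝ} {z : ℝ} (h : ∀ k, x k ≤ z) (n : ℕ) : partialMax x n ≤ z :=
  have : Nonempty (Finset.range (n + 1)) := ⟨⟨0, by simp⟩⟩
  ciSup_le fun _ ↦ h _

lemma tendsto_partialMax {x : ℕ → ℝ} {z : ℝ} (h : IsLUB (Set.range x) z) :
    Filter.Tendsto (partialMax x) Filter.atTop (nhds z) := by
  have hle : ∀ k, x k ≤ z := fun k ↦ h.1 ⟨k, rfl⟩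
  refine tendsto_order.2 ⟨fun a ha ↦ ?_, fun a ha ↦ ?_⟩
  · obtain ⟨_, ⟨k, rfl⟩, hk, -⟩ := h.exists_between ha
    filter_upwards [Filter.eventually_ge_atTop k] with n hn
    exact hk.trans_le (le_partialMax x hn)
  · exact Filter.Eventually.of_forall fun n ↦ (partialMax_le hle n).trans_lt ha

/-- Concentration for the supremum of an almost surely bounded, centered Gaussian sequence with
drift. -/
theorem IsGaussianProcess.integrable_and_concentration_of_isLUB {X : ℕ → Ω → ℝ}
    (hX : IsGaussianProcess X P) (hmean : ∀ k, ∫ ω, X k ω ∂P = 0) {L : ℝ} (hL : 0 < L)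
    (hvar : ∀ k, Var[X k; P] ≤ L) (b : ℕ → ℝ) {Z : Ω → ℝ}
    (hZ : ∀ᵐ ω ∂P, IsLUB (Set.range fun k ↦ X k ω + b k) (Z ω)) :
    Integrable Z P ∧ ∀ u : ℝ, 0 < u →
      P.real {ω | u < |Z ω - ∫ ω', Z ω' ∂P|} ≤
        2 * Real.exp (-(2 / Real.pi ^ 2 * u ^ 2 / L)) := by
  let Y : ℕ → Ω → ℝ := fun n ω ↦ partialMax (fun k ↦ X k ω + b k) n
  let K : ℝ≥0 := ⟨L * (Real.pi / 2) ^ 2, by positivity⟩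
  have hK : (0 : ℝ) < K := show 0 < L * (Real.pi / 2) ^ 2 by positivity
  have hY : ∀ n, Integrable (Y n) P ∧ HasSubgaussianMGF (fun ω ↦ Y n ω - ∫ ω', Y n ω' ∂P) K P := by
    intro n
    have : Nonempty (Finset.range (n + 1)) := ⟨⟨0, by simp⟩⟩
    exact HasGaussianLaw.hasSubgaussianMGF_iSup
      (X := fun i : Finset.range (n + 1) ↦ X i) (hX.hasGaussianLaw (Finset.range (n + 1)))
      (fun i ↦ hmean i) (fun i ↦ hvar i) (fun i ↦ b i) le_rfl
  have hlim : ∀ᵐ ω ∂P, Filter.Tendsto (fun n ↦ Y n ω) Filter.atTop (nhds (Z ω)) := by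
    filter_upwards [hZ] with ω hω using tendsto_partialMax hω
  have hYZ : ∀ᵐ ω ∂P, ∀ n, Y n ω ≤ Z ω := by
    filter_upwards [hZ] with ω hω n
    exact partialMax_le (fun k ↦ hω.1 ⟨k, rfl⟩) n
  have hmono : ∀ n ω, Y 0 ω ≤ Y n ω := fun n ω ↦ by
    have : Nonempty (Finset.range (0 + 1)) := ⟨⟨0, by simp⟩⟩
    refine ciSup_le fun i ↦ le_partialMax (fun k ↦ X k ω + b k) ?_
    have := Finset.mem_range.1 i.2
    omega
  have hYm : ∀ n, AEMeasurable (Y n) P := fun n ↦ (hY n).1.aemeasurable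
  have hZm : AEMeasurable Z P := aemeasurable_of_tendsto_metrizable_ae' hYm hlim
  -- Only almost sure finiteness of `Z` is known. A level `m` not exceeded with probability above
  -- `1/2` bounds the means of the partial maxima, and hence gives integrability.
  obtain ⟨m, hm⟩ : ∃ m : ℝ, 1 / 2 < P.real {ω | Z ω ≤ m} := by
    have : IsProbabilityMeasure (P.map Z) := Measure.isProbabilityMeasure_map hZm
    obtain ⟨m, hm⟩ := ((tendsto_cdf_atTop (P.map Z)).eventually_const_lt
      (show (1 / 2 : ℝ) < 1 by norm_num)).exists
    refine ⟨m, hm.trans_le (le_of_eq ?_)⟩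
    rw [cdf_eq_real, map_measureReal_apply_of_aemeasurable hZm measurableSet_Iic]
    rfl
  have hbound : ∀ n, ∫ ω, Y n ω ∂P ≤ m + 2 * Real.sqrt K := by
    intro n
    -- Otherwise `Z ≤ m` forces `Y n` to lie more than `2 √K` below its mean, an event of
    -- probability at most `2 exp (-2) < 1/2`.
    by_contra! hcon
    have h1 := HasSubgaussianMGF.measure_lt_abs_le (hY n).2 (u := 2 * Real.sqrt K) (by positivity)
    have h2 : P.real {ω | Z ω ≤ m} ≤
        P.real {ω | 2 * Real.sqrt K < |Y n ω - ∫ ω', Y n ω' ∂P|} := by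
      refine ENNReal.toReal_mono (measure_ne_top _ _) (measure_mono_ae ?_)
      filter_upwards [hYZ] with ω hω (hωm : Z ω ≤ m)
      change 2 * Real.sqrt K < |Y n ω - ∫ ω', Y n ω' ∂P|
      rw [abs_sub_comm]
      refine lt_of_lt_of_le ?_ (le_abs_self _)
      linarith [hω n]
    have h3 : -(2 * Real.sqrt K) ^ 2 / (2 * (K : ℝ)) = -2 := by
      rw [mul_pow, Real.sq_sqrt hK.le]
      field_simp
    have h4 : Real.exp (-2) < 1 / 4 := by
      have := Real.quadratic_le_exp_of_nonneg (x := 2) (by norm_num)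
      rw [Real.exp_neg, one_div]
      exact inv_strictAnti₀ (by norm_num) (by linarith)
    rw [h3] at h1
    linarith
  have hZint : Integrable Z P := by
    -- Subtracting `Y 0` makes the increasing sequence nonnegative, so that Fatou's lemma applies.
    have hsub : Integrable (fun ω ↦ Z ω - Y 0 ω) P := by
      refine (lintegral_ofReal_ne_top_iff_integrable (hZm.sub (hYm 0)).aestronglyMeasurable ?_).1 ?_
      · filter_upwards [hYZ] with ω hω using sub_nonneg.2 (hω 0)
      · refine ne_top_of_le_ne_top
          (ENNReal.ofReal_ne_top (r := m + 2 * Real.sqrt K - ∫ ω, Y 0 ω ∂P)) ?_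
        calc ∫⁻ ω, ENNReal.ofReal (Z ω - Y 0 ω) ∂P
            = ∫⁻ ω, Filter.liminf (fun n ↦ ENNReal.ofReal (Y n ω - Y 0 ω)) Filter.atTop ∂P := by
              refine lintegral_congr_ae ?_
              filter_upwards [hlim] with ω hω
              exact (ENNReal.tendsto_ofReal (hω.sub_const _)).liminf_eq.symm
          _ ≤ Filter.liminf (fun n ↦ ∫⁻ ω, ENNReal.ofReal (Y n ω - Y 0 ω) ∂P) Filter.atTop :=
              lintegral_liminf_le' fun n ↦ ((hYm n).sub (hYm 0)).ennreal_ofReal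
          _ ≤ _ := by
              refine Filter.liminf_le_of_le (by isBoundedDefault) fun c hc ↦ ?_
              obtain ⟨n, hn⟩ := hc.exists
              refine hn.trans ?_
              have hi : Integrable (fun ω ↦ Y n ω - Y 0 ω) P := (hY n).1.sub (hY 0).1
              rw [← ofReal_integral_eq_lintegral_ofReal hi
                (ae_of_all _ fun ω ↦ sub_nonneg.2 (hmono n ω)),
                integral_sub (hY n).1 (hY 0).1]
              exact ENNReal.ofReal_le_ofReal (sub_le_sub_right (hbound n) _)
    exact (hsub.add (hY 0).1).congr (ae_of_all _ fun ω ↦ sub_add_cancel (Z ω) (Y 0 ω))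
  have hmeans : Filter.Tendsto (fun n ↦ ∫ ω, Y n ω ∂P) Filter.atTop (nhds (∫ ω, Z ω ∂P)) := by
    refine tendsto_integral_of_dominated_convergence (fun ω ↦ |Y 0 ω| + |Z ω|)
      (fun n ↦ (hYm n).aestronglyMeasurable) ((hY 0).1.abs.add hZint.abs) (fun n ↦ ?_) hlim
    filter_upwards [hYZ] with ω hω
    rw [Real.norm_eq_abs, abs_le]
    constructor
    · linarith [hmono n ω, neg_abs_le (Y 0 ω), abs_nonneg (Z ω)]
    · linarith [hω n, le_abs_self (Z ω), abs_nonneg (Y 0 ω)]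
  refine ⟨hZint, fun u hu ↦ measureReal_lt_abs_le_of_tendsto
    (Y := fun n ω ↦ Y n ω - ∫ ω', Y n ω' ∂P) (fun n ↦ (hYm n).sub_const _) ?_ fun n ↦ ?_⟩
  · filter_upwards [hlim] with ω hω using hω.sub hmeans
  · refine (HasSubgaussianMGF.measure_lt_abs_le (hY n).2 hu.le).trans (le_of_eq ?_)
    have : (K : ℝ) = L * (Real.pi / 2) ^ 2 := rfl
    rw [this]
    congr 2
    field_simp

end GaussianSupremum

/-! ### Truncated variations as countable suprema -/

section IntervalChains

lemma IsStrictIntervalChain.isWeakIntervalChain {s t : ℝ≥0} {n : ℕ} {a b : Fin n → ℝ≥0}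
    (h : IsStrictIntervalChain s t a b) : IsWeakIntervalChain s t a b where
  left_le := h.left_le
  lt := h.lt
  le_right := h.le_right
  ordered i j hij := (h.ordered i j hij).le

/-- The gaps between intervals contribute nonnegative increments of `m`. Removing the last interval
leaves a chain that ends at its left end point. -/
lemma IsWeakIntervalChain.sum_sub_le {s : ℝ≥0} {m : ℝ≥0 → ℝ} (hm : Monotone m) :
    ∀ {n : ℕ} {t : ℝ≥0} {a b : Fin n → ℝ≥0}, s ≤ t → IsWeakIntervalChain s t a b →
      ∑ i, (m (b i) - m (a i)) ≤ m t - m s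
  | 0, t, a, b, hst, _ => by simpa using hm hst
  | n + 1, t, a, b, _, h => by
    rw [Fin.sum_univ_castSucc]
    have hrec := IsWeakIntervalChain.sum_sub_le hm (h.left_le (Fin.last n))
      (a := fun i ↦ a i.castSucc) (b := fun i ↦ b i.castSucc)
      ⟨fun i ↦ h.left_le _, fun i ↦ h.lt _, fun i ↦ h.ordered _ _ (Fin.castSucc_lt_last i),
        fun i j hij ↦ h.ordered _ _ (Fin.castSucc_lt_castSucc_iff.2 hij)⟩
    have hlast := hm (h.le_right (Fin.last n))
    linarith

/-- The variation functional obtained by summing `φ` of the increments of `f` over the interval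
chains selected by `C`. -/
noncomputable def chainVar (C : ∀ n : ℕ, (Fin n → ℝ≥0) → (Fin n → ℝ≥0) → Prop) (φ : ℝ → ℝ)
    (f : ℝ≥0 → ℝ) : ℝ≥0∞ :=
  ⨆ (n : ℕ) (_ : 1 ≤ n) (a : Fin n → ℝ≥0) (b : Fin n → ℝ≥0) (_ : C n a b),
    ENNReal.ofReal (∑ i, φ (f (b i) - f (a i)))

variable {C : ∀ n : ℕ, (Fin n → ℝ≥0) → (Fin n → ℝ≥0) → Prop} {φ : ℝ → ℝ} {f : ℝ≥0 → ℝ}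
  {S : ℝ≥0} {c : ℝ} {T : Set SignType}

lemma le_chainVar {n : ℕ} (hn : 1 ≤ n) {a b : Fin n → ℝ≥0} (h : C n a b) :
    ENNReal.ofReal (∑ i, φ (f (b i) - f (a i))) ≤ chainVar C φ f :=
  le_iSup_of_le n <| le_iSup_of_le hn <| le_iSup_of_le a <| le_iSup_of_le b <|
    le_iSup_of_le h le_rfl

lemma chainVar_le {z : ℝ} (h : ∀ (n : ℕ) (a b : Fin n → ℝ≥0), C n a b →
    ∑ i, φ (f (b i) - f (a i)) ≤ z) : chainVar C φ f ≤ ENNReal.ofReal z :=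
  iSup_le fun n ↦ iSup_le fun _ ↦ iSup_le fun a ↦ iSup_le fun b ↦ iSup_le fun hC ↦
    ENNReal.ofReal_le_ofReal (h n a b hC)

/-- By uniform continuity an interval shorter than `δ` has an increment below `c` and contributes
nothing. A longer one contributes at most `2 M`, hence at most `2 M / δ` times its length, and the
lengths add up to at most `S`. -/
lemma chainVar_ne_top (hf : Continuous f) (hc : 0 < c) (hφ : ∀ x, φ x ≤ max (|x| - c) 0)
    (hC : ∀ {n : ℕ} {a b : Fin n → ℝ≥0}, C n a b → IsWeakIntervalChain 0 S a b) :
    chainVar C φ f ≠ ∞ := by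
  have hcomp : IsCompact (Set.Icc 0 S) := isCompact_Icc
  obtain ⟨δ, hδ, hunif⟩ := Metric.uniformContinuousOn_iff.1
    (hcomp.uniformContinuousOn_of_continuous hf.continuousOn) c hc
  obtain ⟨M, hM⟩ := hcomp.exists_bound_of_continuousOn hf.continuousOn
  have hM0 : 0 ≤ M := (norm_nonneg _).trans (hM 0 ⟨le_rfl, zero_le⟩)
  have hterm : ∀ x ∈ Set.Icc 0 S, ∀ y ∈ Set.Icc 0 S, x ≤ y →
      φ (f y - f x) ≤ 2 * M / δ * y - 2 * M / δ * x := by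
    intro x hx y hy hxy
    have hxy' : (x : ℝ) ≤ y := hxy
    refine (hφ _).trans (max_le ?_ ?_)
    · rcases lt_or_ge ((y : ℝ) - x) δ with h | h
      · have hd : dist y x < δ := by
          rw [NNReal.dist_eq, abs_of_nonneg (by linarith)]
          exact h
        have h1 := hunif y hy x hx hd
        rw [Real.dist_eq] at h1
        have : 0 ≤ 2 * M / δ * ((y : ℝ) - x) := mul_nonneg (by positivity) (by linarith)
        linarith
      · have h1 := hM y hy
        have h2 := hM x hx
        rw [Real.norm_eq_abs] at h1 h2
        have h3 := abs_sub (f y) (f x)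
        have h4 : 2 * M / δ * δ ≤ 2 * M / δ * ((y : ℝ) - x) := by gcongr
        rw [div_mul_cancel₀ _ hδ.ne'] at h4
        linarith
    · have : 0 ≤ 2 * M / δ * ((y : ℝ) - x) := mul_nonneg (by positivity) (by linarith)
      linarith
  refine ne_top_of_le_ne_top (ENNReal.ofReal_ne_top (r := 2 * M / δ * S - 2 * M / δ * (0 : ℝ≥0)))
    (chainVar_le fun n a b hab ↦ ?_)
  have h := hC hab
  refine le_trans (Finset.sum_le_sum fun i _ ↦ hterm (a i) ⟨zero_le, ?_⟩ (b i) ⟨zero_le, ?_⟩ ?_)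
    (h.sum_sub_le (m := fun x ↦ 2 * M / δ * x) (fun x y hxy ↦ ?_) zero_le)
  · exact (h.lt i).le.trans (h.le_right i)
  · exact h.le_right i
  · exact (h.lt i).le
  · have : (x : ℝ) ≤ y := hxy
    simp only
    gcongr

/-- Interval chains in `[0, S]` with end points in a fixed countable dense set, and signs in `T`. -/
structure SignedChain (S : ℝ≥0) (T : Set SignType) where
  /-- The number of intervals. -/
  length : ℕ
  /-- The indices of the left end points in the dense sequence. -/
  leftIndex : Fin length → ℕ
  /-- The indices of the right end points in the dense sequence. -/
  rightIndex : Fin length → ℕ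
  /-- The signs of the intervals. -/
  sign : Fin length → SignType
  isStrictIntervalChain : IsStrictIntervalChain 0 S
    (fun i ↦ TopologicalSpace.denseSeq ℝ≥0 (leftIndex i))
    (fun i ↦ TopologicalSpace.denseSeq ℝ≥0 (rightIndex i))
  sign_mem : ∀ i, sign i ∈ T

namespace SignedChain

instance : Countable (SignedChain S T) := by
  refine Function.Injective.countable (f := fun k : SignedChain S T ↦
    (⟨k.length, k.leftIndex, k.rightIndex, k.sign⟩ :
      Σ n : ℕ, (Fin n → ℕ) × (Fin n → ℕ) × (Fin n → SignType))) ?_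
  rintro ⟨n, a, b, σ, _, _⟩ ⟨n', a', b', σ', _, _⟩ h
  simp only [Sigma.mk.injEq] at h
  obtain ⟨rfl, h⟩ := h
  simp only [heq_eq_eq, Prod.mk.injEq] at h
  obtain ⟨rfl, rfl, rfl⟩ := h
  rfl

/-- The chain without intervals. -/
def empty (S : ℝ≥0) (T : Set SignType) : SignedChain S T :=
  ⟨0, Fin.elim0, Fin.elim0, Fin.elim0,
    ⟨fun i ↦ i.elim0, fun i ↦ i.elim0, fun i ↦ i.elim0, fun i ↦ i.elim0⟩, fun i ↦ i.elim0⟩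

instance : Nonempty (SignedChain S T) := ⟨empty S T⟩

/-- The left end points. -/
noncomputable def left (k : SignedChain S T) (i : Fin k.length) : ℝ≥0 :=
  TopologicalSpace.denseSeq ℝ≥0 (k.leftIndex i)

/-- The right end points. -/
noncomputable def right (k : SignedChain S T) (i : Fin k.length) : ℝ≥0 :=
  TopologicalSpace.denseSeq ℝ≥0 (k.rightIndex i)

/-- The signed sum of the increments of `f`. -/
noncomputable def signedSum (k : SignedChain S T) (f : ℝ≥0 → ℝ) : ℝ :=
  ∑ i, (k.sign i : ℝ) * (f (k.right i) - f (k.left i))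

/-- The total penalty when each interval with a nonzero sign costs `c`. -/
noncomputable def penalty (k : SignedChain S T) (c : ℝ) : ℝ := ∑ i, c * |(k.sign i : ℝ)|

end SignedChain

/-- By `hle` and `hex`, `φ` is a maximum of affine functions indexed by the signs in `T`. Any chain
is a limit of strict chains with dense end points, obtained by shrinking every interval slightly, so
weak and strict chains have the same supremum. -/
lemma isLUB_chainVar (hf : Continuous f) (hφc : Continuous φ)
    (hle : ∀ σ ∈ T, ∀ x, (σ : ℝ) * x - c * |(σ : ℝ)| ≤ φ x)
    (hex : ∀ x, ∃ σ ∈ T, φ x = (σ : ℝ) * x - c * |(σ : ℝ)|)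
    (hCw : ∀ {n : ℕ} {a b : Fin n → ℝ≥0}, C n a b → IsWeakIntervalChain 0 S a b)
    (hsC : ∀ {n : ℕ} {a b : Fin n → ℝ≥0}, IsStrictIntervalChain 0 S a b → C n a b)
    (htop : chainVar C φ f ≠ ∞) :
    IsLUB (Set.range fun k : SignedChain S T ↦ k.signedSum f + -k.penalty c)
      (chainVar C φ f).toReal := by
  constructor
  · rintro _ ⟨k, rfl⟩
    have h1 : k.signedSum f + -k.penalty c ≤ ∑ i, φ (f (k.right i) - f (k.left i)) := by
      rw [← sub_eq_add_neg, SignedChain.signedSum, SignedChain.penalty, ← Finset.sum_sub_distrib]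
      exact Finset.sum_le_sum fun i _ ↦ hle _ (k.sign_mem i) _
    refine h1.trans ?_
    -- The chain without intervals is not among those defining `chainVar`, but its value `0` is
    -- dominated anyway.
    rcases Nat.eq_zero_or_pos k.length with h0 | hpos
    · have : IsEmpty (Fin k.length) := by rw [h0]; infer_instance
      rw [Finset.univ_eq_empty, Finset.sum_empty]
      exact ENNReal.toReal_nonneg
    · exact (ENNReal.ofReal_le_iff_le_toReal htop).1
        (le_chainVar hpos (hsC k.isStrictIntervalChain))
  · intro z hz
    have hz' : ∀ k : SignedChain S T, k.signedSum f + -k.penalty c ≤ z := fun k ↦ hz ⟨k, rfl⟩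
    have hz0 : 0 ≤ z := by
      refine le_trans (le_of_eq ?_) (hz' (SignedChain.empty S T))
      have h1 : (SignedChain.empty S T).signedSum f = 0 :=
        Finset.sum_eq_zero fun i _ ↦ Fin.elim0 i
      have h2 : (SignedChain.empty S T).penalty c = 0 :=
        Finset.sum_eq_zero fun i _ ↦ Fin.elim0 i
      rw [h1, h2, neg_zero, add_zero]
    refine ENNReal.toReal_le_of_le_ofReal hz0 (chainVar_le fun n a b hab ↦ ?_)
    -- The interior points `x i` keep the approximating end points in order: `a i < u i m < x i < v
    -- i m < b i`. Intervals that touch thereby become separated.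
    have h := hCw hab
    have hmid : ∀ i, ∃ x, a i < x ∧ x < b i := fun i ↦ exists_between (h.lt i)
    choose x hax hxb using hmid
    have hD := TopologicalSpace.denseRange_denseSeq ℝ≥0
    have hleft := fun i ↦ Dense.exists_seq_strictAnti_tendsto_of_lt hD (hax i)
    have hright := fun i ↦ Dense.exists_seq_strictMono_tendsto_of_lt hD (hxb i)
    choose u _ hu hulim using hleft
    choose v _ hv hvlim using hright
    choose α hα using fun i m ↦ (hu i m).2
    choose β hβ using fun i m ↦ (hv i m).2
    have hlim : Filter.Tendsto (fun m ↦ ∑ i, φ (f (v i m) - f (u i m))) Filter.atTop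
        (nhds (∑ i, φ (f (b i) - f (a i)))) :=
      tendsto_finsetSum _ fun i _ ↦ (hφc.tendsto _).comp
        (((hf.tendsto _).comp (hvlim i)).sub ((hf.tendsto _).comp (hulim i)))
    refine le_of_tendsto' hlim fun m ↦ ?_
    choose σ hσT hσ using fun i ↦ hex (f (v i m) - f (u i m))
    have huv : IsStrictIntervalChain 0 S (fun i ↦ u i m) (fun i ↦ v i m) :=
      ⟨fun i ↦ zero_le, fun i ↦ (hu i m).1.2.trans (hv i m).1.1,
        fun i ↦ (hv i m).1.2.le.trans (h.le_right i),
        fun i j hij ↦ (hv i m).1.2.trans ((h.ordered i j hij).trans_lt (hu j m).1.1)⟩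
    let k : SignedChain S T := ⟨n, fun i ↦ α i m, fun i ↦ β i m, σ,
      by simpa only [hα, hβ] using huv, hσT⟩
    refine le_trans (le_of_eq ?_) (hz' k)
    rw [← sub_eq_add_neg, SignedChain.signedSum, SignedChain.penalty, ← Finset.sum_sub_distrib]
    refine Finset.sum_congr rfl fun i _ ↦ ?_
    simp only [SignedChain.left, SignedChain.right, k, hα, hβ, hσ]

end IntervalChains

/-! ### Covariance estimates and the deviation bound -/

section FractionalBrownianMotion

/-- The points `r` and `s` are the convex combinations of `p` and `q` with weights `θ` and `1 - θ`
exchanged; the two convexity inequalities add up. -/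
lemma ConvexOn.add_le_add_of_sum_eq {g : ℝ → ℝ} (hg : ConvexOn ℝ Set.univ g) {p q r s : ℝ}
    (hpr : p ≤ r) (hps : p ≤ s) (hsum : r + s = p + q) : g r + g s ≤ g p + g q := by
  rcases hpr.eq_or_lt with rfl | hpr'
  · rw [show s = q by linarith]
  have hd : 0 < q - p := by linarith
  set θ := (r - p) / (q - p) with hθ
  have hθ0 : 0 ≤ θ := div_nonneg (by linarith) hd.le
  have hθ1 : 0 ≤ 1 - θ := by
    rw [sub_nonneg, hθ, div_le_one hd]
    linarith
  have hmul : θ * (q - p) = r - p := div_mul_cancel₀ _ hd.ne'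
  have h1 := hg.2 (Set.mem_univ p) (Set.mem_univ q) hθ1 hθ0 (by ring)
  have h2 := hg.2 (Set.mem_univ p) (Set.mem_univ q) hθ0 hθ1 (by ring)
  simp only [smul_eq_mul] at h1 h2
  rw [show (1 - θ) * p + θ * q = r by linarith] at h1
  rw [show θ * p + (1 - θ) * q = s by linarith] at h2
  linarith

lemma convexOn_abs_rpow {p : ℝ} (hp : 1 ≤ p) : ConvexOn ℝ Set.univ fun x : ℝ ↦ |x| ^ p := by
  refine ⟨convex_univ, fun x _ y _ a b ha hb hab ↦ ?_⟩
  calc |a • x + b • y| ^ p ≤ (a • |x| + b • |y|) ^ p := by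
        gcongr
        refine (abs_add_le _ _).trans (le_of_eq ?_)
        rw [smul_eq_mul, smul_eq_mul, abs_mul, abs_mul, abs_of_nonneg ha, abs_of_nonneg hb]
        rfl
    _ ≤ a • |x| ^ p + b • |y| ^ p :=
        (convexOn_rpow hp).2 (abs_nonneg x) (abs_nonneg y) ha hb hab

/-- The covariance function of fractional Brownian motion. -/
noncomputable def fbmCov (H : ℝ) (s t : ℝ≥0) : ℝ :=
  (1 / 2) * (|(s : ℝ)| ^ (2 * H) + |(t : ℝ)| ^ (2 * H) - |(t : ℝ) - s| ^ (2 * H))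

lemma fbmCov_comm (H : ℝ) (s t : ℝ≥0) : fbmCov H s t = fbmCov H t s := by
  simp only [fbmCov, abs_sub_comm (t : ℝ) s]
  ring

lemma fbmCov_zero_left {H : ℝ} (hH : 0 < H) (t : ℝ≥0) : fbmCov H 0 t = 0 := by
  simp [fbmCov, Real.zero_rpow (show 2 * H ≠ 0 by positivity)]

lemma fbmCov_self {H : ℝ} (hH : 0 < H) (t : ℝ≥0) : fbmCov H t t = (t : ℝ) ^ (2 * H) := by
  simp only [fbmCov, sub_self, abs_zero, Real.zero_rpow (show 2 * H ≠ 0 by positivity),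
    NNReal.abs_eq]
  ring

/-- Increments of fractional Brownian motion with `1 / 2 ≤ H` are nonnegatively correlated. -/
lemma monotone_fbmCov_sub {H : ℝ} (hH : 1 / 2 ≤ H) {a b : ℝ≥0} (hab : a ≤ b) :
    Monotone fun t ↦ fbmCov H t b - fbmCov H t a := by
  intro s t hst
  have hab' : (a : ℝ) ≤ b := hab
  have hst' : (s : ℝ) ≤ t := hst
  -- The mixed difference of the covariance is half that of `|x| ^ (2 * H)`, a convex function
  -- because `1 ≤ 2 * H`. Here `a - t` and `b - s` are the outer points.
  have h := (convexOn_abs_rpow (show 1 ≤ 2 * H by linarith)).add_le_add_of_sum_eq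
    (p := (a : ℝ) - t) (q := (b : ℝ) - s) (r := (a : ℝ) - s) (s := (b : ℝ) - t)
    (by linarith) (by linarith) (by ring)
  simp only [fbmCov] at h ⊢
  linarith

variable {Ω : Type*} [MeasurableSpace Ω] {P : Measure Ω} {W : ℝ≥0 → Ω → ℝ} {H : ℝ}

namespace IsFractionalBrownianMotion

lemma memLp (hW : IsFractionalBrownianMotion W H P) (t : ℝ≥0) : MemLp (W t) 2 P :=
  (hW.gaussian.hasGaussianLaw_eval t).memLp_two

lemma integral_mul (hW : IsFractionalBrownianMotion W H P) (s t : ℝ≥0) :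
    ∫ ω, W s ω * W t ω ∂P = fbmCov H s t := hW.covariance s t

lemma integral_increment_mul (hW : IsFractionalBrownianMotion W H P) (a b a' b' : ℝ≥0) :
    ∫ ω, (W b ω - W a ω) * (W b' ω - W a' ω) ∂P =
      (fbmCov H b b' - fbmCov H b a') - (fbmCov H a b' - fbmCov H a a') := by
  have hi : ∀ s t, Integrable (fun ω ↦ W s ω * W t ω) P :=
    fun s t ↦ (hW.memLp s).integrable_mul (hW.memLp t)
  have e : ∀ ω, (W b ω - W a ω) * (W b' ω - W a' ω) =
      (W b ω * W b' ω - W b ω * W a' ω) - (W a ω * W b' ω - W a ω * W a' ω) := fun ω ↦ by ring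
  simp_rw [e]
  have hi' : ∀ s t r, Integrable (fun ω ↦ W s ω * W t ω - W s ω * W r ω) P :=
    fun s t r ↦ (hi s t).sub (hi s r)
  rw [integral_sub (hi' _ _ _) (hi' _ _ _), integral_sub (hi _ _) (hi _ _),
    integral_sub (hi _ _) (hi _ _)]
  simp_rw [hW.integral_mul]

/-- The increment covariances `D i j` are nonnegative, so all signs may be replaced by `1`. Filling
the gaps between intervals, first in `i` and then in `j`, increases the sum up to the variance of
`W_S`. -/
lemma integral_sq_signed_sum_le (hW : IsFractionalBrownianMotion W H P) (hH : 1 / 2 ≤ H)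
    {n : ℕ} {a b : Fin n → ℝ≥0} {S : ℝ≥0}
    (h : IsWeakIntervalChain 0 S a b) {σ : Fin n → ℝ} (hσ : ∀ i, |σ i| ≤ 1) :
    ∫ ω, (∑ i, σ i * (W (b i) ω - W (a i) ω)) ^ 2 ∂P ≤ (S : ℝ) ^ (2 * H) := by
  have hH0 : 0 < H := by linarith
  let D : Fin n → Fin n → ℝ := fun i j ↦
    (fbmCov H (b i) (b j) - fbmCov H (b i) (a j)) - (fbmCov H (a i) (b j) - fbmCov H (a i) (a j))
  have hmono := fun j ↦ monotone_fbmCov_sub hH (h.lt j).le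
  have hD : ∀ i j, 0 ≤ D i j := fun i j ↦ sub_nonneg.2 (hmono j (h.lt i).le)
  have hi : ∀ i j, Integrable
      (fun ω ↦ (W (b i) ω - W (a i) ω) * (W (b j) ω - W (a j) ω)) P := fun i j ↦
    ((hW.memLp _).sub (hW.memLp _)).integrable_mul ((hW.memLp _).sub (hW.memLp _))
  have hmonoS : Monotone fun t ↦ fbmCov H S t := by
    intro s t hst
    have := monotone_fbmCov_sub hH hst (zero_le : 0 ≤ S)
    simp only [fbmCov_zero_left hH0] at this
    simp only
    linarith
  calc ∫ ω, (∑ i, σ i * (W (b i) ω - W (a i) ω)) ^ 2 ∂P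
      = ∫ ω, ∑ i, ∑ j, σ i * σ j *
          ((W (b i) ω - W (a i) ω) * (W (b j) ω - W (a j) ω)) ∂P := by
        refine integral_congr_ae (ae_of_all _ fun ω ↦ ?_)
        simp only
        rw [sq, Finset.sum_mul_sum]
        refine Finset.sum_congr rfl fun i _ ↦ Finset.sum_congr rfl fun j _ ↦ ?_
        ring
    _ = ∑ i, ∑ j, σ i * σ j * D i j := by
        rw [integral_finsetSum _ fun i _ ↦ integrable_finsetSum _ fun j _ ↦ (hi i j).const_mul _]
        refine Finset.sum_congr rfl fun i _ ↦ ?_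
        rw [integral_finsetSum _ fun j _ ↦ (hi i j).const_mul _]
        refine Finset.sum_congr rfl fun j _ ↦ ?_
        rw [integral_const_mul, hW.integral_increment_mul]
    _ ≤ ∑ i, ∑ j, D i j := by
        refine Finset.sum_le_sum fun i _ ↦ Finset.sum_le_sum fun j _ ↦ ?_
        refine mul_le_of_le_one_left (hD i j) ((le_abs_self _).trans ?_)
        rw [abs_mul]
        exact mul_le_one₀ (hσ i) (abs_nonneg _) (hσ j)
    _ = ∑ j, ∑ i, D i j := Finset.sum_comm
    _ ≤ ∑ j, (fbmCov H S (b j) - fbmCov H S (a j)) := by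
        refine Finset.sum_le_sum fun j _ ↦ ?_
        have := h.sum_sub_le (hmono j) zero_le
        simp only [fbmCov_zero_left hH0, sub_zero] at this
        exact this
    _ ≤ fbmCov H S S - fbmCov H S 0 := h.sum_sub_le hmonoS zero_le
    _ = (S : ℝ) ^ (2 * H) := by
        rw [fbmCov_comm H S 0, fbmCov_zero_left hH0, fbmCov_self hH0, sub_zero]

variable {S : ℝ≥0} {c : ℝ} {T : Set SignType}

lemma isGaussianProcess_signedSum (hW : IsFractionalBrownianMotion W H P) :
    IsGaussianProcess (fun (k : SignedChain S T) ω ↦ k.signedSum fun t ↦ W t ω) P := by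
  classical
  refine hW.gaussian.of_isGaussianProcess fun k ↦ ?_
  let I : Finset ℝ≥0 := Finset.univ.image k.left ∪ Finset.univ.image k.right
  have hl : ∀ i, k.left i ∈ I := fun i ↦ by simp [I]
  have hr : ∀ i, k.right i ∈ I := fun i ↦ by simp [I]
  refine ⟨I, ∑ i, (k.sign i : ℝ) • (ContinuousLinearMap.proj (R := ℝ) (φ := fun _ : I ↦ ℝ)
    ⟨k.right i, hr i⟩ - ContinuousLinearMap.proj (R := ℝ) (φ := fun _ : I ↦ ℝ)
    ⟨k.left i, hl i⟩), fun ω ↦ ?_⟩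
  simp [SignedChain.signedSum]

lemma integral_signedSum (hW : IsFractionalBrownianMotion W H P) (k : SignedChain S T) :
    ∫ ω, (k.signedSum fun t ↦ W t ω) ∂P = 0 := by
  have hi : ∀ t, Integrable (W t) P := fun t ↦ (hW.gaussian.hasGaussianLaw_eval t).integrable
  have hi' : ∀ i, Integrable (fun ω ↦ (k.sign i : ℝ) * (W (k.right i) ω - W (k.left i) ω)) P :=
    fun i ↦ ((hi _).sub (hi _)).const_mul _
  unfold SignedChain.signedSum
  rw [integral_finsetSum _ fun i _ ↦ hi' i]
  refine Finset.sum_eq_zero fun i _ ↦ ?_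
  rw [integral_const_mul, integral_sub (hi _) (hi _), hW.centered, hW.centered, sub_self, mul_zero]

lemma variance_signedSum_le (hW : IsFractionalBrownianMotion W H P) (hH : 1 / 2 ≤ H)
    (k : SignedChain S T) :
    Var[fun ω ↦ k.signedSum fun t ↦ W t ω; P] ≤ (S : ℝ) ^ (2 * H) := by
  rw [variance_of_integral_eq_zero
    (hW.isGaussianProcess_signedSum.aemeasurable k) (hW.integral_signedSum k)]
  refine hW.integral_sq_signed_sum_le hH k.isStrictIntervalChain.isWeakIntervalChain
    (σ := fun i ↦ (k.sign i : ℝ)) fun i ↦ ?_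
  cases k.sign i <;> simp

theorem gaussianDeviationBound_chainVar (hW : IsFractionalBrownianMotion W H P)
    [IsProbabilityMeasure P] (hH : 1 / 2 ≤ H) (hS : 0 < S)
    (hc : 0 < c) {C : ∀ n : ℕ, (Fin n → ℝ≥0) → (Fin n → ℝ≥0) → Prop} {φ : ℝ → ℝ}
    (hφc : Continuous φ) (hφ : ∀ x, φ x ≤ max (|x| - c) 0)
    (hle : ∀ σ ∈ T, ∀ x, (σ : ℝ) * x - c * |(σ : ℝ)| ≤ φ x)
    (hex : ∀ x, ∃ σ ∈ T, φ x = (σ : ℝ) * x - c * |(σ : ℝ)|)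
    (hCw : ∀ {n : ℕ} {a b : Fin n → ℝ≥0}, C n a b → IsWeakIntervalChain 0 S a b)
    (hsC : ∀ {n : ℕ} {a b : Fin n → ℝ≥0}, IsStrictIntervalChain 0 S a b → C n a b) :
    GaussianDeviationBound P (fun ω ↦ chainVar C φ fun t ↦ W t ω) H S c 2 (2 / Real.pi ^ 2) := by
  have hH0 : 0 < H := by linarith
  have hS' : (0 : ℝ) < S := hS
  have hfin : ∀ᵐ ω ∂P, chainVar C φ (fun t ↦ W t ω) ≠ ∞ := by
    filter_upwards [hW.continuous_paths] with ω hω using chainVar_ne_top hω hc hφ hCw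
  obtain ⟨e, he⟩ := exists_surjective_nat (SignedChain S T)
  have hlub : ∀ᵐ ω ∂P, IsLUB (Set.range fun n ↦ ((e n).signedSum fun t ↦ W t ω) +
      -(e n).penalty c) (chainVar C φ fun t ↦ W t ω).toReal := by
    filter_upwards [hW.continuous_paths, hfin] with ω hω hω'
    have h := isLUB_chainVar (T := T) hω hφc hle hex hCw hsC hω'
    rwa [← he.range_comp] at h
  obtain ⟨hint, hconc⟩ := IsGaussianProcess.integrable_and_concentration_of_isLUB
    (hW.isGaussianProcess_signedSum.comp_right e) (fun n ↦ hW.integral_signedSum (e n))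
    (Real.rpow_pos_of_pos hS' (2 * H)) (fun n ↦ hW.variance_signedSum_le hH (e n))
    (fun n ↦ -(e n).penalty c) hlub
  have hbound : ∀ u : ℝ, 0 < u →
      P.real {ω | u < |(chainVar C φ fun t ↦ W t ω).toReal -
        ∫ ω', (chainVar C φ fun t ↦ W t ω').toReal ∂P|} ≤
      2 * Real.exp (-(2 / Real.pi ^ 2 * (S : ℝ) ^ (-(2 * H)) * u ^ 2)) := by
    intro u hu
    refine (hconc u hu).trans (le_of_eq ?_)
    rw [Real.rpow_neg hS'.le]
    congr 3
    field_simp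
  -- The second form is the first at `u = S c ^ (1 - 1/H) v`, since `S ^ (-2H) (S c ^ (1 - 1/H))² =
  -- (S c ^ (-1/H)) ^ (2 - 2H)`.
  refine ⟨hfin, hint, hbound, fun v hv ↦ ?_⟩
  refine (hbound _ (by positivity)).trans (le_of_eq ?_)
  congr 3
  have h1 : ((S : ℝ) * c ^ (1 - 1 / H)) ^ 2 = (S : ℝ) ^ (2 : ℝ) * c ^ (2 - 2 / H) := by
    rw [mul_pow, ← Real.rpow_natCast (c ^ (1 - 1 / H)) 2, ← Real.rpow_mul hc.le,
      ← Real.rpow_natCast (S : ℝ) 2]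
    congr 2
    push_cast
    ring
  have h2 : ((S : ℝ) * c ^ (-(1 / H))) ^ (2 - 2 * H) =
      (S : ℝ) ^ (2 - 2 * H) * c ^ (2 - 2 / H) := by
    rw [Real.mul_rpow hS'.le (by positivity), ← Real.rpow_mul hc.le]
    congr 2
    field_simp
    ring
  have h3 : (S : ℝ) ^ (2 - 2 * H) = (S : ℝ) ^ (-(2 * H)) * (S : ℝ) ^ (2 : ℝ) := by
    rw [← Real.rpow_add hS']
    congr 1
    ring
  rw [h2, h3, mul_pow, h1]
  ring

end IsFractionalBrownianMotion

end FractionalBrownianMotion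

/-! ### The three truncated variations -/

section TruncatedVariation

variable {Ω : Type*} [MeasurableSpace Ω] {P : Measure Ω} [IsProbabilityMeasure P]
  {W : ℝ≥0 → Ω → ℝ} {H : ℝ} {S : ℝ≥0} {c : ℝ}

namespace IsFractionalBrownianMotion

theorem gaussianDeviationBound_truncVar (hW : IsFractionalBrownianMotion W H P) (hH : 1 / 2 ≤ H)
    (hS : 0 < S) (hc : 0 < c) :
    GaussianDeviationBound P (fun ω ↦ truncVar (fun t ↦ W t ω) 0 S c) H S c
      2 (2 / Real.pi ^ 2) := by
  refine hW.gaussianDeviationBound_chainVar (T := Set.univ) hH hS hc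
    (C := fun _ a b ↦ IsWeakIntervalChain 0 S a b) (φ := fun x ↦ max (|x| - c) 0)
    (by fun_prop) (fun _ ↦ le_rfl) (fun σ _ x ↦ ?_) (fun x ↦ ?_) id
    IsStrictIntervalChain.isWeakIntervalChain
  · cases σ
    · simp
    · refine le_max_of_le_left ?_
      have := neg_le_abs x
      simpa using this
    · refine le_max_of_le_left ?_
      have := le_abs_self x
      simpa using this
  · rcases le_total (|x| - c) 0 with h | h
    · exact ⟨0, trivial, by simpa using h⟩
    · rcases abs_cases x with ⟨hx, -⟩ | ⟨hx, -⟩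
      · exact ⟨1, trivial, by rw [max_eq_left h, hx]; simp⟩
      · exact ⟨-1, trivial, by rw [max_eq_left h, hx]; simp⟩

theorem gaussianDeviationBound_upTruncVar (hW : IsFractionalBrownianMotion W H P) (hH : 1 / 2 ≤ H)
    (hS : 0 < S) (hc : 0 < c) :
    GaussianDeviationBound P (fun ω ↦ upTruncVar (fun t ↦ W t ω) 0 S c) H S c
      2 (2 / Real.pi ^ 2) := by
  refine hW.gaussianDeviationBound_chainVar (T := {0, 1}) hH hS hc
    (C := fun _ a b ↦ IsStrictIntervalChain 0 S a b) (φ := fun x ↦ max (x - c) 0)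
    (by fun_prop) (fun x ↦ ?_) (fun σ hσ x ↦ ?_) (fun x ↦ ?_)
    IsStrictIntervalChain.isWeakIntervalChain id
  · gcongr
    exact le_abs_self x
  · rcases hσ with rfl | rfl <;> simp
  · rcases le_total (x - c) 0 with h | h
    · exact ⟨0, by simp, by simpa using h⟩
    · exact ⟨1, by simp, by rw [max_eq_left h]; simp⟩

theorem gaussianDeviationBound_downTruncVar (hW : IsFractionalBrownianMotion W H P)
    (hH : 1 / 2 ≤ H) (hS : 0 < S) (hc : 0 < c) :
    GaussianDeviationBound P (fun ω ↦ downTruncVar (fun t ↦ W t ω) 0 S c) H S c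
      2 (2 / Real.pi ^ 2) := by
  have h := hW.gaussianDeviationBound_chainVar (T := {0, -1}) hH hS hc
    (C := fun _ a b ↦ IsStrictIntervalChain 0 S a b) (φ := fun x ↦ max (-x - c) 0)
    (by fun_prop) (fun x ↦ ?_) (fun σ hσ x ↦ ?_) (fun x ↦ ?_)
    IsStrictIntervalChain.isWeakIntervalChain id
  -- The drop `f (a i) - f (b i)` is the negative of the increment to which `φ` is applied.
  · simp only [chainVar, neg_sub] at h
    exact h
  · gcongr
    exact neg_le_abs x
  · rcases hσ with rfl | rfl <;> simp
  · rcases le_total (-x - c) 0 with h | h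
    · exact ⟨0, by simp, by simpa using h⟩
    · exact ⟨-1, by simp, by rw [max_eq_left h]; simp⟩

end IsFractionalBrownianMotion

end TruncatedVariation

theorem theorem2 :
    (∃ A B : ℝ, 0 < A ∧ A ≤ 4 ∧ 2 / Real.pi ^ 2 ≤ B ∧
      ∀ (Ω : Type*) [MeasurableSpace Ω] (P : Measure Ω) [IsProbabilityMeasure P]
        (H : ℝ) (_ : 1 / 2 ≤ H) (_ : H < 1) (W : ℝ≥0 → Ω → ℝ)
        (_ : IsFractionalBrownianMotion W H P)
        (S : ℝ≥0) (_ : 0 < S) (c : ℝ) (_ : 0 < c) (_ : c ≤ (S : ℝ) ^ H),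
        GaussianDeviationBound P (fun ω => truncVar (fun t => W t ω) 0 S c) H S c A B) ∧
    (∃ A B : ℝ, 0 < A ∧ A ≤ 2 ∧ 2 / Real.pi ^ 2 ≤ B ∧
      ∀ (Ω : Type*) [MeasurableSpace Ω] (P : Measure Ω) [IsProbabilityMeasure P]
        (H : ℝ) (_ : 1 / 2 ≤ H) (_ : H < 1) (W : ℝ≥0 → Ω → ℝ)
        (_ : IsFractionalBrownianMotion W H P)
        (S : ℝ≥0) (_ : 0 < S) (c : ℝ) (_ : 0 < c) (_ : c ≤ (S : ℝ) ^ H),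
        GaussianDeviationBound P (fun ω => upTruncVar (fun t => W t ω) 0 S c) H S c A B ∧
        GaussianDeviationBound P (fun ω => downTruncVar (fun t => W t ω) 0 S c) H S c A B) := by
  -- The bound with constant `2` holds for all three functionals, so `A = 2` also serves where `4`
  -- is allowed.
  refine ⟨⟨2, 2 / Real.pi ^ 2, by norm_num, by norm_num, le_rfl, ?_⟩,
    ⟨2, 2 / Real.pi ^ 2, by norm_num, le_rfl, le_rfl, ?_⟩⟩
  · intro Ω _ P _ H hH _ W hW S hS c hc _
    exact hW.gaussianDeviationBound_truncVar hH hS hc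
  · intro Ω _ P _ H hH _ W hW S hS c hc _
    exact ⟨hW.gaussianDeviationBound_upTruncVar hH hS hc,
      hW.gaussianDeviationBound_downTruncVar hH hS hc⟩
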